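/- **Setting.** Let $N\ge K+2$, $K\ge 2$, $\varepsilon=1/N$, and let $\mathcal U=\{u\in\mathbb R^{2N+1}: u_{-N}=u_N=0\}$ (indices $-N,\dots,N$). Put $v'_\ell=\varepsilon^{-1}(v_\ell-v_{\ell-1})$, $\langle v,w\rangle=\varepsilon\sum_{\ell=-N+1}^N v_\ell w_\ell$ and $\|v\|_{\mathcal U^{1,2}}=\big(\varepsilon\sum_{\ell=-N+1}^N|v'_\ell|^2\big)^{1/2}$; for a linear map $A:\mathcal U\to\mathcal U$ let $\|A\|_{\mathcal U^{1,2}}=\sup_{v\ne0}\|Av\|_{\mathcal U^{1,2}}/\|v\|_{\mathcal U^{1,2}}$. Let $\phi''_F>0$ and $\phi''_{2F}$ be real numbers (the second derivatives of the pair potential at $F$ and $2F$) and $A_F=\phi''_F+4\phi''_{2F}$. Write $(\Delta_1v)_j=\varepsilon^{-2}(-v_{j+1}+2v_j-v_{j-1})$ and $(\Delta_2v)_j=\varepsilon^{-2}(-v_{j+2}+2v_j-v_{j-2})$. For $|j|\le N-1$, the force-based operator is $$(L^{\rm qcf}v)_j=\begin{cases}\phi''_F(\Delta_1v)_j+\phi''_{2F}(\Delta_2v)_j,&|j|\le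 K,\\ A_F(\Delta_1v)_j,&|j|>K,\end{cases}$$ and the energy-based operator is, for $0\le j\le N-1$, $$(L^{\rm qce}v)_j=\phi''_F(\Delta_1v)_j+\phi''_{2F}\begin{cases}(\Delta_2v)_j,&j\le K-2,\\ (\Delta_2v)_j+\frac{v_{j+2}-v_j}{2\varepsilon^2},&j=K-1,\\ (\Delta_2v)_j-\frac{2(v_{j+1}-v_j)}{\varepsilon^2}+\frac{v_{j+2}-v_j}{2\varepsilon^2},&j=K,\\ 4(\Delta_1v)_j-\frac{2(v_j-v_{j-1})}{\varepsilon^2}+\frac{v_j-v_{j-2}}{2\varepsilon^2},&j=K+1,\\ 4(\Delta_1v)_j+\frac{v_j-v_{j-2}}{2\varepsilon^2},&j=K+2,\\ 4(\Delta_1v)_j,&j\ge K+3,\end{cases}$$ the rows $j<0$ being obtained by the reflection $j\mapsto-j$. Both are regarded as operators on $\mathcal U$ (value $0$ at $j=\pm N$). Let $\lambda_K$ be the number, depending only on $K$, with $$\inf_{N\ge K+2}\ \inf_{u\in\mathcal U,\ \|u\|_{\mathcal U^{1,2}}=1}\langle L^{\rm qce}u,u\rangle=A_F+\lambda_K\phi''_{2F}\qquad\text{whenever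 }\phi''_{2F}\le0;$$ equivalently, $-\lambda_K$ is this infimum for $\phi''_F=4$, $\phi''_{2F}=-1$. When $L^{\rm qce}$ is invertible, the iteration operator of the ghost force correction (GFC) is $G_{\rm qce}=I-(L^{\rm qce})^{-1}L^{\rm qcf}$. **Proposition.** Let $\phi''_F>0$ and $\phi''_{2F}\neq0$. There are $C>0$ and $N_0\in\mathbb N$, depending only on $\phi''_F$ and $\phi''_{2F}$, such that for all $N\ge N_0$ and all $K$ with $2\le K\le N/2$ and $A_F+\lambda_K\phi''_{2F}>0$, the operator $L^{\rm qce}$ is invertible and $$C^{-1}N^{1/2}\ \le\ \|G_{\rm qce}\|_{\mathcal U^{1,2}}\ \le\ C\,N^{1/2},\qquad \|G_{\rm qce}\|_{\mathcal U^{1,2}}>1 .$$ In particular, the GFC iteration is not a contraction in $\mathcal U^{1,2}$ for large $N$, and hence not a uniform contraction, however far the strain is from the critical one. -/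

import Mathlib

noncomputable section

namespace QC

/-- The displacement space for the chain of `2N+1` atoms `-N, …, N` with both ends clamped:
`u_{-N} = u_N = 0`.  A displacement is stored as a function on `ℤ`, extended by zero. -/
def Disp (N : ℕ) : Submodule ℝ (ℤ → ℝ) where
  carrier := {u | ∀ j : ℤ, (N : ℤ) ≤ |j| → u j = 0}
  zero_mem' := fun _ _ => rfl
  add_mem' := by
    intro u v hu hv j hj
    simp [hu j hj, hv j hj]
  smul_mem' := by
    intro c u hu j hj
    simp [hu j hj]

/-- The lattice spacing `ε = 1/N`. -/
def eps (N : ℕ) : ℝ := 1 / (N : ℝ)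

/-- The backward difference quotient `v'_ℓ = (v_ℓ - v_{ℓ-1}) / ε`. -/
def strain (N : ℕ) (v : ℤ → ℝ) (l : ℤ) : ℝ := (v l - v (l - 1)) / eps N

/-- The inner product `⟨v, w⟩ = ε ∑_{ℓ=-N+1}^{N} v_ℓ w_ℓ`. -/
def ip (N : ℕ) (v w : ℤ → ℝ) : ℝ :=
  eps N * ∑ l ∈ Finset.Icc (-(N : ℤ) + 1) (N : ℤ), v l * w l

/-- The discrete Sobolev norm `‖v‖_{U^{1,2}} = ‖v'‖_{ℓ²_ε}`. -/
def normU12 (N : ℕ) (v : ℤ → ℝ) : ℝ :=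
  Real.sqrt (eps N * ∑ l ∈ Finset.Icc (-(N : ℤ) + 1) (N : ℤ), |strain N v l| ^ 2)

/-- The operator norm on `U^{1,2}`: the supremum of `‖A v‖ / ‖v‖` over nonzero displacements. -/
def opNormU12 (N : ℕ) (A : Module.End ℝ (Disp N)) : ℝ :=
  sSup {r : ℝ | ∃ v : Disp N, v ≠ 0 ∧ r = normU12 N (A v) / normU12 N v}

/-- Nearest-neighbour second difference `(-v_{j+1} + 2 v_j - v_{j-1}) / ε²`. -/
def lap1 (N : ℕ) (v : ℤ → ℝ) (j : ℤ) : ℝ :=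
  (-v (j + 1) + 2 * v j - v (j - 1)) / eps N ^ 2

/-- Next-nearest-neighbour second difference `(-v_{j+2} + 2 v_j - v_{j-2}) / ε²`. -/
def lap2 (N : ℕ) (v : ℤ → ℝ) (j : ℤ) : ℝ :=
  (-v (j + 2) + 2 * v j - v (j - 2)) / eps N ^ 2

/-- The linearized atomistic operator, with `a = φ''_F` and `b = φ''_{2F}`. -/
def atRow (N : ℕ) (a b : ℝ) (v : ℤ → ℝ) (j : ℤ) : ℝ :=
  a * lap1 N v j + b * lap2 N v j

/-- The linearized local quasicontinuum operator `A_F L`, where `A_F = φ''_F + 4 φ''_{2F}`. -/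
def qclRow (N : ℕ) (a b : ℝ) (v : ℤ → ℝ) (j : ℤ) : ℝ :=
  (a + 4 * b) * lap1 N v j

/-- The linearized force-based operator: atomistic rows for `|j| ≤ K`, local rows elsewhere. -/
def qcfRow (N K : ℕ) (a b : ℝ) (v : ℤ → ℝ) (j : ℤ) : ℝ :=
  if |j| ≤ (K : ℤ) then atRow N a b v j else qclRow N a b v j

/-- The rows `j ≥ 0` of the linearized energy-based quasicontinuum operator. -/
def qceHalfRow (N K : ℕ) (a b : ℝ) (v : ℤ → ℝ) (j : ℤ) : ℝ :=
  a * lap1 N v j + b *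
    (if j ≤ (K : ℤ) - 2 then lap2 N v j
    else if j = (K : ℤ) - 1 then
      lap2 N v j + 1 / eps N * ((v (j + 2) - v j) / (2 * eps N))
    else if j = (K : ℤ) then
      lap2 N v j - 2 / eps N * ((v (j + 1) - v j) / eps N)
        + 1 / eps N * ((v (j + 2) - v j) / (2 * eps N))
    else if j = (K : ℤ) + 1 then
      4 * lap1 N v j - 2 / eps N * ((v j - v (j - 1)) / eps N)
        + 1 / eps N * ((v j - v (j - 2)) / (2 * eps N))
    else if j = (K : ℤ) + 2 then
      4 * lap1 N v j + 1 / eps N * ((v j - v (j - 2)) / (2 * eps N))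
    else 4 * lap1 N v j)

/-- All rows of the linearized energy-based operator; the rows `j < 0` are the mirror images of
the rows `j > 0` under the reflection `j ↦ -j`. -/
def qceRow (N K : ℕ) (a b : ℝ) (v : ℤ → ℝ) (j : ℤ) : ℝ :=
  if 0 ≤ j then qceHalfRow N K a b v j
  else qceHalfRow N K a b (fun i => v (-i)) (-j)

theorem qceHalfRow_add (N K : ℕ) (a b : ℝ) (v w : ℤ → ℝ) (j : ℤ) :
    qceHalfRow N K a b (v + w) j = qceHalfRow N K a b v j + qceHalfRow N K a b w j := by
  simp only [qceHalfRow, lap1, lap2, Pi.add_apply]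
  split_ifs <;> ring

theorem qceHalfRow_smul (N K : ℕ) (a b c : ℝ) (v : ℤ → ℝ) (j : ℤ) :
    qceHalfRow N K a b (c • v) j = c * qceHalfRow N K a b v j := by
  simp only [qceHalfRow, lap1, lap2, Pi.smul_apply, smul_eq_mul]
  split_ifs <;> ring

theorem qceRow_add (N K : ℕ) (a b : ℝ) (v w : ℤ → ℝ) (j : ℤ) :
    qceRow N K a b (v + w) j = qceRow N K a b v j + qceRow N K a b w j := by
  unfold qceRow
  split_ifs
  · exact qceHalfRow_add N K a b v w j
  · exact qceHalfRow_add N K a b (fun i => v (-i)) (fun i => w (-i)) (-j)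

theorem qceRow_smul (N K : ℕ) (a b c : ℝ) (v : ℤ → ℝ) (j : ℤ) :
    qceRow N K a b (c • v) j = c * qceRow N K a b v j := by
  unfold qceRow
  split_ifs
  · exact qceHalfRow_smul N K a b c v j
  · exact qceHalfRow_smul N K a b c (fun i => v (-i)) (-j)

/-- The force-based operator on the displacement space: its rows at the free atoms `|j| < N`,
and the value zero at the clamped atoms. -/
def Lqcf (N K : ℕ) (a b : ℝ) : Module.End ℝ (Disp N) where
  toFun u := ⟨fun j => if |j| < (N : ℤ) then qcfRow N K a b (u : ℤ → ℝ) j else 0,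
    fun _ hj => if_neg (not_lt.mpr hj)⟩
  map_add' := by
    intro u v
    ext j
    simp only [Submodule.coe_add, Pi.add_apply, qcfRow, atRow, qclRow, lap1, lap2]
    split_ifs <;> ring
  map_smul' := by
    intro c u
    ext j
    simp only [Submodule.coe_smul, Pi.smul_apply, smul_eq_mul, RingHom.id_apply, qcfRow, atRow,
      qclRow, lap1, lap2]
    split_ifs <;> ring

/-- The energy-based operator on the displacement space: its rows at the free atoms `|j| < N`,
and the value zero at the clamped atoms. -/
def Lqce (N K : ℕ) (a b : ℝ) : Module.End ℝ (Disp N) where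
  toFun u := ⟨fun j => if |j| < (N : ℤ) then qceRow N K a b (u : ℤ → ℝ) j else 0,
    fun _ hj => if_neg (not_lt.mpr hj)⟩
  map_add' := by
    intro u v
    ext j
    change (if |j| < (N : ℤ) then qceRow N K a b ((u : ℤ → ℝ) + (v : ℤ → ℝ)) j else 0) =
      (if |j| < (N : ℤ) then qceRow N K a b (u : ℤ → ℝ) j else 0) +
      (if |j| < (N : ℤ) then qceRow N K a b (v : ℤ → ℝ) j else 0)
    rw [qceRow_add]
    split_ifs <;> ring
  map_smul' := by
    intro c u
    ext j
    change (if |j| < (N : ℤ) then qceRow N K a b (c • (u : ℤ → ℝ)) j else 0) =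
      c * (if |j| < (N : ℤ) then qceRow N K a b (u : ℤ → ℝ) j else 0)
    rw [qceRow_smul]
    split_ifs <;> ring

/-- The iteration matrix `G = I - (L^{qce})⁻¹ L^{qcf}` of the ghost force correction. -/
def Gqce (N K : ℕ) (a b : ℝ) : Module.End ℝ (Disp N) :=
  1 - Ring.inverse (Lqce N K a b) * Lqcf N K a b

/-- The stability constant of the energy-based operator with atomistic half-width `K`:
the infimum of `⟨L^{qce} u, u⟩` over `‖u'‖ = 1` and over all admissible chain lengths. -/
def qceStab (K : ℕ) (a b : ℝ) : ℝ :=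
  sInf {r : ℝ | ∃ N : ℕ, K + 2 ≤ N ∧ ∃ u : Disp N,
    normU12 N u = 1 ∧ r = ip N (Lqce N K a b u) u}

/-- The number `λ_K` such that the stability constant is `A_F + λ_K φ''_{2F}` for all
`φ''_{2F} ≤ 0`, where `A_F = φ''_F + 4 φ''_{2F}`.  The form `⟨L^{qce} u, u⟩` is
`A_F ‖u'‖² + φ''_{2F} q(u)` with `q` independent of the coefficients, so `λ_K` can be read off at
`A_F = 0`, `φ''_{2F} = -1`, that is, at `φ''_F = 4`, `φ''_{2F} = -1`. -/
def lamK (K : ℕ) : ℝ := -qceStab K 4 (-1)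

end QC

end

/-! For `g = Gqce v` one has `L^{qce} g = (L^{qce} - L^{qcf}) v`, so both bounds concern the
response of the energy-based operator to this residual. The energy-based operator is in divergence
form, hence has an exact weak form in the strains; the force-based one is not conservative. Their
difference lives on four atoms at each interface. There it is of size `|b| / ε` times the local
strain, and at the right interface its entries add up to `b / ε` times a second difference of the
strain, which is a net force.

Upper bound: a single strain can reach `√N ‖v‖`, while `g` is bounded pointwise by `√2 ‖g‖`. Testing
with `g` itself gives `c ‖g‖² ≤ const · |b| √N ‖v‖ ‖g‖`, where `c` is a coercivity constant.

Lower bound: a bump at one interface has norm `√(6N)` but a residual with net force of order `N²`.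
The test function is a plateau, flat across the atomistic region and both interfaces, so that it
sees this force (weighted by `ε`) while the energy-based operator reduces to `A_F` times the inner
product of strains. This forces `‖g‖` to be of order `N`, a factor `√N` above the bump.

The constant `c` must not depend on `K`. For `b ≥ 0` it is `a`. For `b ≤ 0` it comes from
`lamK_antitone`: `A_F + λ_K b` does not decrease with `K`, so the smallest admissible `K` supplies a
constant for all others. Monotonicity follows by reducing `λ_K` to a form on half a chain without
the mean-zero constraint (`neg_lamK_mul_le_halfForm`), from which a bond can be removed
(`halfForm_shift_le`). -/

noncomputable section

namespace QC

/-! ### Divergence form of the energy-based operator -/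

/-- The next-nearest-neighbour stress of the energy-based operator in the bonds `l ≥ 1`, as a
function of the strain `d`. -/
def halfFlux (K : ℕ) (d : ℤ → ℝ) (l : ℤ) : ℝ :=
  if l ≤ (K : ℤ) - 1 then d (l - 1) + 2 * d l + d (l + 1)
  else if l = (K : ℤ) then d (l - 1) + 3 / 2 * d l + 1 / 2 * d (l + 1)
  else if l = (K : ℤ) + 1 then 1 / 2 * d (l - 1) + 3 * d l + 1 / 2 * d (l + 1)
  else if l = (K : ℤ) + 2 then 1 / 2 * d (l - 1) + 9 / 2 * d l
  else 4 * d l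

/-- The mirror image of a strain: the reflection `j ↦ -j` of the atoms maps bond `l` to `1 - l`. -/
def mirror (d : ℤ → ℝ) (l : ℤ) : ℝ := d (1 - l)

/-- The next-nearest-neighbour stress of the energy-based operator. -/
def flux (K : ℕ) (d : ℤ → ℝ) (l : ℤ) : ℝ :=
  if 1 ≤ l then halfFlux K d l else halfFlux K (mirror d) (1 - l)

/-- The stress of the energy-based operator. -/
def stress (K : ℕ) (a b : ℝ) (d : ℤ → ℝ) (l : ℤ) : ℝ := a * d l + b * flux K d l

theorem eps_pos {N : ℕ} (hN : 0 < N) : 0 < eps N := by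
  unfold eps; positivity

theorem qceHalfRow_eq_halfFlux {N : ℕ} (hN : 0 < N) (K : ℕ) (a b : ℝ) (v : ℤ → ℝ) (j : ℤ) :
    qceHalfRow N K a b v j =
      ((a * strain N v j + b * halfFlux K (strain N v) j) -
        (a * strain N v (j + 1) + b * halfFlux K (strain N v) (j + 1))) / eps N := by
  have he := (eps_pos hN).ne'
  unfold qceHalfRow halfFlux lap1 lap2 strain
  rcases lt_trichotomy j ((K : ℤ) + 1) with h | h | h
  · rcases lt_trichotomy j ((K : ℤ) - 1) with h' | h' | h'
    · have h1 : j ≤ (K : ℤ) - 2 := by omega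
      have h2 : j ≤ (K : ℤ) - 1 := by omega
      have h3 : j + 1 ≤ (K : ℤ) - 1 := by omega
      simp only [h1, h2, h3, if_true]
      ring_nf
    · subst h'
      have h1 : ¬ (K : ℤ) - 1 ≤ (K : ℤ) - 2 := by omega
      simp [h1]
      ring_nf
    · obtain rfl : j = K := by omega
      have h1 : ¬ (K : ℤ) ≤ (K : ℤ) - 2 := by omega
      have h2 : ¬ (K : ℤ) = (K : ℤ) - 1 := by omega
      simp [h1, h2]
      ring_nf
  · subst h
    have h1 : ¬ (K : ℤ) + 1 ≤ (K : ℤ) - 2 := by omega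
    have h2 : ¬ (K : ℤ) + 1 ≤ (K : ℤ) - 1 := by omega
    have h3 : ¬ (K : ℤ) + 1 = (K : ℤ) - 1 := by omega
    have h4 : ¬ (K : ℤ) + 1 + 1 ≤ (K : ℤ) - 1 := by omega
    have h5 : (K : ℤ) + 1 + 1 = (K : ℤ) + 2 := by omega
    simp [h1, h2, h3, h5]
    ring_nf
  · by_cases h' : j = (K : ℤ) + 2
    · subst h'
      have h1 : ¬ (K : ℤ) + 2 ≤ (K : ℤ) - 2 := by omega
      have h2 : ¬ (K : ℤ) + 2 ≤ (K : ℤ) - 1 := by omega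
      have h3 : ¬ (K : ℤ) + 2 = (K : ℤ) - 1 := by omega
      have h4 : ¬ (K : ℤ) + 2 + 1 ≤ (K : ℤ) - 1 := by omega
      have h5 : ¬ (K : ℤ) + 2 + 1 = (K : ℤ) := by omega
      have h6 : ¬ (K : ℤ) + 2 + 1 = (K : ℤ) + 1 := by omega
      simp [h1, h2, h3, h4, h5, h6]
      ring_nf
    · rw [if_neg (by omega), if_neg (by omega), if_neg (by omega), if_neg (by omega),
        if_neg (by omega), if_neg (by omega), if_neg (by omega), if_neg (by omega),
        if_neg (by omega), if_neg (by omega), if_neg (by omega), if_neg (by omega),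
        if_neg (by omega)]
      ring_nf

theorem strain_reflect (N : ℕ) (v : ℤ → ℝ) (l : ℤ) :
    strain N (fun i => v (-i)) l = -mirror (strain N v) l := by
  simp only [strain, mirror]
  rw [show -(l - 1) = 1 - l by ring, show 1 - l - 1 = -l by ring]
  ring

theorem halfFlux_neg (K : ℕ) (d : ℤ → ℝ) (l : ℤ) :
    halfFlux K (fun i => -d i) l = -halfFlux K d l := by
  unfold halfFlux
  split_ifs <;> ring

theorem flux_of_nonpos {K : ℕ} (hK : 2 ≤ K) (d : ℤ → ℝ) {l : ℤ} (hl : l ≤ 1) :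
    flux K d l = halfFlux K (mirror d) (1 - l) := by
  unfold flux
  split_ifs with h
  · obtain rfl : l = 1 := by omega
    simp only [halfFlux, mirror]
    rw [if_pos (by omega), if_pos (by omega)]
    norm_num
    ring
  · rfl

/-- Since `K ≥ 2`, bonds 0 and 1 are interior, where the atomistic stress is mirror symmetric; the
right-half formula therefore still holds at bond 0, which the row of atom 0 needs. -/
theorem flux_of_nonneg {K : ℕ} (hK : 2 ≤ K) (d : ℤ → ℝ) {l : ℤ} (hl : 0 ≤ l) :
    flux K d l = halfFlux K d l := by
  unfold flux
  split_ifs with h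
  · rfl
  · obtain rfl : l = 0 := by omega
    simp only [halfFlux, mirror]
    rw [if_pos (by omega), if_pos (by omega)]
    norm_num
    ring

theorem qceRow_eq_stress {N K : ℕ} (hN : 0 < N) (hK : 2 ≤ K) (a b : ℝ) (v : ℤ → ℝ) (j : ℤ) :
    qceRow N K a b v j =
      (stress K a b (strain N v) j - stress K a b (strain N v) (j + 1)) / eps N := by
  unfold qceRow stress
  split_ifs with h
  · rw [qceHalfRow_eq_halfFlux hN, flux_of_nonneg hK _ h, flux_of_nonneg hK _ (by omega)]
  · rw [qceHalfRow_eq_halfFlux hN, flux_of_nonpos hK _ (by omega : j ≤ 1),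
      flux_of_nonpos hK _ (by omega : j + 1 ≤ 1)]
    have hs : strain N (fun i => v (-i)) = fun i => -mirror (strain N v) i :=
      funext (strain_reflect N v)
    rw [hs, halfFlux_neg, halfFlux_neg]
    simp only [mirror]
    rw [show 1 - -j = j + 1 by ring, show 1 - (-j + 1) = j by ring,
      show 1 - (j + 1) = -j by ring, show 1 - j = -j + 1 by ring]
    ring

/-! ### Weak form and quadratic form -/

/-- A sum over the bonds, folded along the reflection `l ↦ 1 - l`. -/
theorem sum_bonds (N : ℕ) (f : ℤ → ℝ) :
    ∑ l ∈ Finset.Icc (-(N : ℤ) + 1) (N : ℤ), f l =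
      ∑ i ∈ Finset.range N, (f ((i : ℤ) + 1) + f (-(i : ℤ))) := by
  induction N with
  | zero => simp
  | succ n ih =>
    rw [Finset.sum_range_succ, ← ih]
    have h : Finset.Icc (-((n + 1 : ℕ) : ℤ) + 1) ((n + 1 : ℕ) : ℤ) =
        insert ((n : ℤ) + 1) (insert (-(n : ℤ)) (Finset.Icc (-(n : ℤ) + 1) (n : ℤ))) := by
      ext x
      simp only [Finset.mem_insert, Finset.mem_Icc]
      push_cast
      omega
    rw [h, Finset.sum_insert (by simp; omega), Finset.sum_insert (by simp)]
    ring

/-- Summation by parts on the clamped chain. -/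
theorem sum_by_parts (N : ℕ) (s w : ℤ → ℝ) (h1 : w (-(N : ℤ)) = 0) (h2 : w N = 0) :
    ∑ l ∈ Finset.Icc (-(N : ℤ) + 1) (N : ℤ), (s l - s (l + 1)) * w l =
      ∑ l ∈ Finset.Icc (-(N : ℤ) + 1) (N : ℤ), s l * (w l - w (l - 1)) := by
  -- The boundary terms are kept for the induction: `w` need not vanish at `±n` when `n < N`.
  have key : ∀ n : ℕ, ∑ l ∈ Finset.Icc (-(n : ℤ) + 1) (n : ℤ),
      ((s l - s (l + 1)) * w l - s l * (w l - w (l - 1))) =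
      s (-(n : ℤ) + 1) * w (-(n : ℤ)) - s ((n : ℤ) + 1) * w n := by
    intro n
    rw [sum_bonds]
    induction n with
    | zero => simp
    | succ n ih =>
      rw [Finset.sum_range_succ, ih]
      push_cast
      rw [show (n : ℤ) + 1 - 1 = n by ring, show -(n : ℤ) - 1 = -((n : ℤ) + 1) by ring,
        show -((n : ℤ) + 1) + 1 = -n by ring]
      ring
  have := key N
  rw [Finset.sum_sub_distrib, h1, h2] at this
  linarith

theorem disp_eq_zero {N : ℕ} (u : Disp N) {j : ℤ} (hj : (N : ℤ) ≤ |j|) :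
    (u : ℤ → ℝ) j = 0 := u.2 j hj

/-- The weak form of the energy-based operator. -/
theorem ip_Lqce {N K : ℕ} (hN : 0 < N) (hK : 2 ≤ K) (a b : ℝ) (u w : Disp N) :
    ip N (Lqce N K a b u) w = eps N * ∑ l ∈ Finset.Icc (-(N : ℤ) + 1) (N : ℤ),
      stress K a b (strain N u) l * strain N w l := by
  have he := (eps_pos hN).ne'
  unfold ip
  congr 1
  have e1 : ∀ l ∈ Finset.Icc (-(N : ℤ) + 1) (N : ℤ),
      (Lqce N K a b u : ℤ → ℝ) l * (w : ℤ → ℝ) l =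
      (eps N)⁻¹ * ((stress K a b (strain N u) l - stress K a b (strain N u) (l + 1)) *
        (w : ℤ → ℝ) l) := by
    intro l hl
    change (if |l| < (N : ℤ) then qceRow N K a b (u : ℤ → ℝ) l else 0) * _ = _
    split_ifs with h
    · rw [qceRow_eq_stress hN hK]; ring
    · rw [disp_eq_zero w (not_lt.mp h)]; ring
  rw [Finset.sum_congr rfl e1, ← Finset.mul_sum,
    sum_by_parts N _ _ (disp_eq_zero w (by simp)) (disp_eq_zero w (by simp)), Finset.mul_sum]
  refine Finset.sum_congr rfl fun l _ => ?_
  unfold strain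
  ring

/-- The next-nearest-neighbour part of the energy of one half of the chain, subtracted from its
Cauchy-Born value `4 ∑ d²`. -/
def halfForm (K : ℕ) (d : ℤ → ℝ) : ℝ :=
  ∑ i ∈ Finset.range (K - 1), (d ((i : ℤ) + 2) - d ((i : ℤ) + 1)) ^ 2
    + 1 / 2 * (d ((K : ℤ) + 1) - d K) ^ 2 + 1 / 2 * (d ((K : ℤ) + 2) - d ((K : ℤ) + 1)) ^ 2
    + d K ^ 2 - d ((K : ℤ) + 2) ^ 2

/-- In the interior, `d_l (d_{l-1} + 2 d_l + d_{l+1})` is `4 d_l²` minus squared differences, up to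
telescoping terms; bonds beyond `K + 2` contribute exactly `4 d²`. The leftover `d 1 * (d 1 - d 0)`
joins its mirror image to form `(d 1 - d 0)²`. -/
theorem sum_halfFlux {N K : ℕ} (hK : 2 ≤ K) (hN : K + 2 ≤ N) (d : ℤ → ℝ) :
    ∑ i ∈ Finset.range N, halfFlux K d ((i : ℤ) + 1) * d ((i : ℤ) + 1) =
      4 * ∑ i ∈ Finset.range N, d ((i : ℤ) + 1) ^ 2 - halfForm K d - d 1 * (d 1 - d 0) := by
  obtain ⟨k, rfl⟩ : ∃ k, K = k + 1 := ⟨K - 1, by omega⟩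
  obtain ⟨m, rfl⟩ := Nat.exists_eq_add_of_le hN
  induction m with
  | succ m ih =>
    rw [show k + 1 + 2 + (m + 1) = (k + 1 + 2 + m) + 1 by ring, Finset.sum_range_succ,
      Finset.sum_range_succ _ (k + 1 + 2 + m), ih (by omega)]
    unfold halfFlux
    push_cast
    rw [if_neg (by omega), if_neg (by omega), if_neg (by omega), if_neg (by omega)]
    ring
  | zero =>
    have key : ∀ n : ℕ, n ≤ k → ∑ i ∈ Finset.range n,
        halfFlux (k + 1) d ((i : ℤ) + 1) * d ((i : ℤ) + 1) =
        4 * ∑ i ∈ Finset.range n, d ((i : ℤ) + 1) ^ 2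
          - ∑ i ∈ Finset.range n, (d ((i : ℤ) + 2) - d ((i : ℤ) + 1)) ^ 2
          + d ((n : ℤ) + 1) ^ 2 - d 1 ^ 2 + d 0 * d 1 - d n * d ((n : ℤ) + 1) := by
      intro n hn
      induction n with
      | zero => simp
      | succ n ih =>
        rw [Finset.sum_range_succ, ih (by omega), Finset.sum_range_succ, Finset.sum_range_succ]
        unfold halfFlux
        push_cast
        rw [if_pos (by omega), show (n : ℤ) + 1 - 1 = n by ring,
          show (n : ℤ) + 1 + 1 = n + 2 by ring]
        ring
    rw [show k + 1 + 2 + 0 = k + 1 + 1 + 1 by ring, Finset.sum_range_succ, Finset.sum_range_succ,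
      Finset.sum_range_succ, key k le_rfl, Finset.sum_range_succ _ (k + 1 + 1),
      Finset.sum_range_succ _ (k + 1), Finset.sum_range_succ _ k]
    unfold halfForm
    rw [Nat.add_sub_cancel]
    have f1 : halfFlux (k + 1) d ((k : ℤ) + 1) =
        d k + 3 / 2 * d ((k : ℤ) + 1) + 1 / 2 * d ((k : ℤ) + 2) := by
      unfold halfFlux
      push_cast
      rw [if_neg (by omega), if_pos rfl]
      ring_nf
    have f2 : halfFlux (k + 1) d ((k : ℤ) + 2) =
        1 / 2 * d ((k : ℤ) + 1) + 3 * d ((k : ℤ) + 2) + 1 / 2 * d ((k : ℤ) + 3) := by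
      unfold halfFlux
      push_cast
      rw [if_neg (by omega), if_neg (by omega), if_pos (by omega)]
      ring_nf
    have f3 : halfFlux (k + 1) d ((k : ℤ) + 3) =
        1 / 2 * d ((k : ℤ) + 2) + 9 / 2 * d ((k : ℤ) + 3) := by
      unfold halfFlux
      push_cast
      rw [if_neg (by omega), if_neg (by omega), if_neg (by omega), if_pos (by omega)]
      ring_nf
    push_cast
    rw [show (k : ℤ) + 1 + 1 = k + 2 by ring, show (k : ℤ) + 1 + 2 = k + 3 by ring,
      show (k : ℤ) + 2 + 1 = k + 3 by ring, f1, f2, f3]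
    ring

theorem sum_flux {N K : ℕ} (hK : 2 ≤ K) (hN : K + 2 ≤ N) (d : ℤ → ℝ) :
    ∑ l ∈ Finset.Icc (-(N : ℤ) + 1) (N : ℤ), flux K d l * d l =
      4 * ∑ l ∈ Finset.Icc (-(N : ℤ) + 1) (N : ℤ), d l ^ 2
        - halfForm K d - halfForm K (mirror d) - (d 1 - d 0) ^ 2 := by
  rw [sum_bonds, sum_bonds, Finset.sum_add_distrib, Finset.sum_add_distrib]
  have e1 : ∑ i ∈ Finset.range N, flux K d ((i : ℤ) + 1) * d ((i : ℤ) + 1) =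
      ∑ i ∈ Finset.range N, halfFlux K d ((i : ℤ) + 1) * d ((i : ℤ) + 1) :=
    Finset.sum_congr rfl fun i _ => by rw [flux_of_nonneg hK _ (by omega)]
  have e2 : ∑ i ∈ Finset.range N, flux K d (-(i : ℤ)) * d (-(i : ℤ)) =
      ∑ i ∈ Finset.range N, halfFlux K (mirror d) ((i : ℤ) + 1) * mirror d ((i : ℤ) + 1) :=
    Finset.sum_congr rfl fun i _ => by
      rw [flux_of_nonpos hK _ (by omega), mirror, show 1 - ((i : ℤ) + 1) = -i by ring,
        show 1 - -(i : ℤ) = i + 1 by ring]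
  have e3 : ∑ i ∈ Finset.range N, mirror d ((i : ℤ) + 1) ^ 2 =
      ∑ i ∈ Finset.range N, d (-(i : ℤ)) ^ 2 :=
    Finset.sum_congr rfl fun i _ => by
      rw [mirror, show 1 - ((i : ℤ) + 1) = -i by ring]
  rw [e1, e2, sum_halfFlux hK hN, sum_halfFlux hK hN, e3]
  simp only [mirror, sub_self, sub_zero]
  ring

/-- Apply `(x - y)² ≤ 2x² + 2y²` to every difference. Bond 1 occurs in only one of them, and the
slack `2 * d 1 ^ 2` later pays for the central term `(d 1 - d 0)²`. -/
theorem halfForm_le {N K : ℕ} (hK : 2 ≤ K) (hN : K + 2 ≤ N) (d : ℤ → ℝ) :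
    halfForm K d ≤ 4 * ∑ i ∈ Finset.range N, d ((i : ℤ) + 1) ^ 2 - 2 * d 1 ^ 2 := by
  obtain ⟨k, rfl⟩ : ∃ k, K = k + 1 := ⟨K - 1, by omega⟩
  have key : ∀ n : ℕ, ∑ i ∈ Finset.range n, (d ((i : ℤ) + 2) - d ((i : ℤ) + 1)) ^ 2 ≤
      4 * ∑ i ∈ Finset.range n, d ((i : ℤ) + 1) ^ 2 + 2 * d ((n : ℤ) + 1) ^ 2 - 2 * d 1 ^ 2 := by
    intro n
    induction n with
    | zero => simp
    | succ n ih =>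
      rw [Finset.sum_range_succ, Finset.sum_range_succ]
      push_cast
      rw [show (n : ℤ) + 1 + 1 = n + 2 by ring]
      nlinarith [sq_nonneg (d ((n : ℤ) + 2) + d ((n : ℤ) + 1))]
  have mono : ∑ i ∈ Finset.range (k + 2), d ((i : ℤ) + 1) ^ 2 ≤
      ∑ i ∈ Finset.range N, d ((i : ℤ) + 1) ^ 2 :=
    Finset.sum_le_sum_of_subset_of_nonneg (Finset.range_mono (by omega))
      fun _ _ _ => sq_nonneg _
  rw [Finset.sum_range_succ, Finset.sum_range_succ] at mono
  have := key k
  unfold halfForm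
  rw [Nat.add_sub_cancel]
  push_cast at *
  rw [show (k : ℤ) + 1 + 1 = k + 2 by ring, show (k : ℤ) + 1 + 2 = k + 3 by ring] at *
  nlinarith [sq_nonneg (d ((k : ℤ) + 2) + d ((k : ℤ) + 1)),
    sq_nonneg (d ((k : ℤ) + 3) + d ((k : ℤ) + 2)), sq_nonneg (d ((k : ℤ) + 2))]

/-- The only negative term sits at bond `K + 2`. This keeps the set in `qceStab` bounded below, so
that its `sInf` is a genuine infimum. -/
theorem neg_sum_le_halfForm {N K : ℕ} (hN : K + 2 ≤ N) (d : ℤ → ℝ) :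
    -∑ i ∈ Finset.range N, d ((i : ℤ) + 1) ^ 2 ≤ halfForm K d := by
  have h1 : d ((K : ℤ) + 2) ^ 2 ≤ ∑ i ∈ Finset.range N, d ((i : ℤ) + 1) ^ 2 := by
    have := Finset.single_le_sum (f := fun i : ℕ => d ((i : ℤ) + 1) ^ 2)
      (fun _ _ => sq_nonneg _) (Finset.mem_range.mpr (show K + 1 < N by omega))
    push_cast at this
    rwa [show (K : ℤ) + 1 + 1 = K + 2 by ring] at this
  have h2 : 0 ≤ ∑ i ∈ Finset.range (K - 1), (d ((i : ℤ) + 2) - d ((i : ℤ) + 1)) ^ 2 :=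
    Finset.sum_nonneg fun _ _ => sq_nonneg _
  unfold halfForm
  nlinarith [sq_nonneg (d ((K : ℤ) + 1) - d K), sq_nonneg (d ((K : ℤ) + 2) - d ((K : ℤ) + 1)),
    sq_nonneg (d K)]

/-- Lengthening the atomistic region by one atom raises the half-chain form. -/
theorem halfForm_shift_le {K : ℕ} (hK : 2 ≤ K) (d : ℤ → ℝ) :
    halfForm K (fun l => d (l + 1)) ≤ halfForm (K + 1) d := by
  obtain ⟨k, rfl⟩ : ∃ k, K = k + 1 := ⟨K - 1, by omega⟩
  unfold halfForm
  rw [Nat.add_sub_cancel, Nat.add_sub_cancel, Finset.sum_range_succ']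
  push_cast
  have : ∀ i : ℕ, (d ((i : ℤ) + 2 + 1) - d ((i : ℤ) + 1 + 1)) ^ 2 =
      (d ((i : ℤ) + 1 + 2) - d ((i : ℤ) + 1 + 1)) ^ 2 := fun i => by
    rw [show (i : ℤ) + 2 + 1 = i + 1 + 2 by ring]
  simp only [this]
  rw [show (k : ℤ) + 1 + 2 + 1 = k + 1 + 1 + 2 by ring]
  nlinarith [sq_nonneg (d ((0 : ℤ) + 2) - d ((0 : ℤ) + 1))]

/-! ### The discrete Sobolev norm -/

theorem normU12_nonneg (N : ℕ) (v : ℤ → ℝ) : 0 ≤ normU12 N v := Real.sqrt_nonneg _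

theorem normU12_sq {N : ℕ} (hN : 0 < N) (v : ℤ → ℝ) :
    normU12 N v ^ 2 = eps N * ∑ l ∈ Finset.Icc (-(N : ℤ) + 1) (N : ℤ), strain N v l ^ 2 := by
  have := eps_pos hN
  unfold normU12
  rw [Real.sq_sqrt (by positivity)]
  simp only [sq_abs]

theorem strain_smul (N : ℕ) (c : ℝ) (v : ℤ → ℝ) (l : ℤ) :
    strain N (c • v) l = c * strain N v l := by
  simp only [strain, Pi.smul_apply, smul_eq_mul]
  ring

theorem normU12_smul (N : ℕ) {c : ℝ} (hc : 0 ≤ c) (v : ℤ → ℝ) :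
    normU12 N (c • v) = c * normU12 N v := by
  unfold normU12
  simp only [strain_smul, abs_mul, mul_pow, ← Finset.mul_sum]
  rw [mul_left_comm, Real.sqrt_mul (by positivity), Real.sqrt_sq_eq_abs, abs_abs, abs_of_nonneg hc]

theorem ip_smul_smul (N : ℕ) (c : ℝ) (v w : ℤ → ℝ) :
    ip N (c • v) (c • w) = c ^ 2 * ip N v w := by
  simp only [ip, Pi.smul_apply, smul_eq_mul]
  rw [mul_left_comm, Finset.mul_sum (a := c ^ 2)]
  congr 1
  exact Finset.sum_congr rfl fun _ _ => by ring

/-- Cauchy-Schwarz for the strains. -/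
theorem abs_sum_strain_le {N : ℕ} (hN : 0 < N) (v w : ℤ → ℝ) :
    |eps N * ∑ l ∈ Finset.Icc (-(N : ℤ) + 1) (N : ℤ), strain N v l * strain N w l| ≤
      normU12 N v * normU12 N w := by
  have he := eps_pos hN
  apply abs_le_of_sq_le_sq _ (mul_nonneg (normU12_nonneg N v) (normU12_nonneg N w))
  rw [mul_pow, mul_pow, normU12_sq hN, normU12_sq hN]
  have := Finset.sum_mul_sq_le_sq_mul_sq (Finset.Icc (-(N : ℤ) + 1) (N : ℤ))
    (strain N v) (strain N w)
  nlinarith [mul_le_mul_of_nonneg_left this (sq_nonneg (eps N))]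

theorem abs_le_sum_abs_diff (v : ℤ → ℝ) (m : ℤ) (hm : v m = 0) (n : ℕ) :
    |v (m + n)| ≤ ∑ l ∈ Finset.Icc (m + 1) (m + n), |v l - v (l - 1)| := by
  induction n with
  | zero => simp [hm]
  | succ n ih =>
    have h : Finset.Icc (m + 1) (m + (n + 1 : ℕ)) =
        insert (m + (n + 1 : ℕ)) (Finset.Icc (m + 1) (m + n)) := by
      ext x
      simp only [Finset.mem_insert, Finset.mem_Icc]
      push_cast
      omega
    rw [h, Finset.sum_insert (by simp)]
    have e : m + ((n + 1 : ℕ) : ℤ) - 1 = m + n := by push_cast; ring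
    rw [e]
    have := abs_sub_abs_le_abs_sub (v (m + ((n + 1 : ℕ) : ℤ))) (v (m + n))
    linarith

/-- The discrete Sobolev inequality on the clamped chain. -/
theorem abs_le_normU12 {N : ℕ} (hN : 0 < N) (u : Disp N) (j : ℤ) :
    |(u : ℤ → ℝ) j| ≤ Real.sqrt 2 * normU12 N u := by
  have he := eps_pos hN
  by_cases hj : (N : ℤ) ≤ |j|
  · rw [disp_eq_zero u hj, abs_zero]
    have := normU12_nonneg N u
    positivity
  rw [not_le, abs_lt] at hj
  obtain ⟨n, hn⟩ : ∃ n : ℕ, j = -(N : ℤ) + n := ⟨(j + N).toNat, by omega⟩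
  have h1 := abs_le_sum_abs_diff u (-(N : ℤ)) (disp_eq_zero u (by simp)) n
  rw [← hn] at h1
  have h2 : ∑ l ∈ Finset.Icc (-(N : ℤ) + 1) j, |(u : ℤ → ℝ) l - (u : ℤ → ℝ) (l - 1)| ≤
      ∑ l ∈ Finset.Icc (-(N : ℤ) + 1) (N : ℤ), |(u : ℤ → ℝ) l - (u : ℤ → ℝ) (l - 1)| :=
    Finset.sum_le_sum_of_subset_of_nonneg (Finset.Icc_subset_Icc le_rfl (by omega))
      fun _ _ _ => abs_nonneg _
  have h3 : ∑ l ∈ Finset.Icc (-(N : ℤ) + 1) (N : ℤ), |(u : ℤ → ℝ) l - (u : ℤ → ℝ) (l - 1)| =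
      eps N * ∑ l ∈ Finset.Icc (-(N : ℤ) + 1) (N : ℤ), |strain N u l| := by
    rw [Finset.mul_sum]
    refine Finset.sum_congr rfl fun l _ => ?_
    rw [strain, abs_div, abs_of_pos he]
    field_simp
  -- Cauchy-Schwarz over `2N` bonds of length `1/N`: the total length 2 is the source of `√2`.
  have h4 := sq_sum_le_card_mul_sum_sq (s := Finset.Icc (-(N : ℤ) + 1) (N : ℤ))
    (f := fun l => |strain N u l|)
  have hcard : ((Finset.Icc (-(N : ℤ) + 1) (N : ℤ)).card : ℝ) = 2 * N := by
    rw [Int.card_Icc, show (N : ℤ) + 1 - (-N + 1) = ((2 * N : ℕ) : ℤ) by push_cast; ring,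
      Int.toNat_natCast]
    push_cast; ring
  have heN : eps N * N = 1 := by
    have : (N : ℝ) ≠ 0 := by positivity
    unfold eps; field_simp
  simp only [sq_abs] at h4
  rw [hcard] at h4
  have h5 := normU12_sq hN u
  refine (h1.trans (h2.trans h3.le)).trans (abs_le_of_sq_le_sq' ?_ ?_).2
  · rw [mul_pow, mul_pow, Real.sq_sqrt (by norm_num), h5]
    calc _ ≤ eps N ^ 2 * (2 * N * ∑ l ∈ Finset.Icc (-(N : ℤ) + 1) (N : ℤ), strain N u l ^ 2) :=
          mul_le_mul_of_nonneg_left h4 (sq_nonneg _)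
      _ = 2 * (eps N * N) * (eps N *
          ∑ l ∈ Finset.Icc (-(N : ℤ) + 1) (N : ℤ), strain N u l ^ 2) := by ring
      _ = _ := by rw [heN]; ring
  · exact mul_nonneg (Real.sqrt_nonneg _) (normU12_nonneg N u)

theorem eq_zero_of_normU12 {N : ℕ} (hN : 0 < N) (u : Disp N) (h : normU12 N u = 0) : u = 0 := by
  ext j
  have := abs_le_normU12 hN u j
  rw [h, mul_zero] at this
  simpa using abs_nonpos_iff.mp this

theorem normU12_pos {N : ℕ} (hN : 0 < N) {u : Disp N} (h : u ≠ 0) : 0 < normU12 N u :=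
  (normU12_nonneg N u).lt_of_ne fun h0 => h (eq_zero_of_normU12 hN u h0.symm)

/-! ### Coercivity for a fixed atomistic region -/

/-- The quadratic form of the energy-based operator. -/
theorem ip_Lqce_self {N K : ℕ} (hK : 2 ≤ K) (hN : K + 2 ≤ N) (a b : ℝ) (u : Disp N) :
    ip N (Lqce N K a b u) u = (a + 4 * b) * normU12 N u ^ 2 - b * (eps N *
      (halfForm K (strain N u) + halfForm K (mirror (strain N u)) +
        (strain N u 1 - strain N u 0) ^ 2)) := by
  rw [ip_Lqce (by omega) hK, normU12_sq (by omega)]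
  have e : ∑ l ∈ Finset.Icc (-(N : ℤ) + 1) (N : ℤ),
      stress K a b (strain N u) l * strain N u l =
      a * ∑ l ∈ Finset.Icc (-(N : ℤ) + 1) (N : ℤ), strain N u l ^ 2 +
      b * ∑ l ∈ Finset.Icc (-(N : ℤ) + 1) (N : ℤ),
        flux K (strain N u) l * strain N u l := by
    rw [Finset.mul_sum, Finset.mul_sum, ← Finset.sum_add_distrib]
    refine Finset.sum_congr rfl fun l _ => ?_
    unfold stress
    ring
  rw [e, sum_flux hK hN]
  ring

theorem sum_sq_bonds (N : ℕ) (d : ℤ → ℝ) :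
    ∑ l ∈ Finset.Icc (-(N : ℤ) + 1) (N : ℤ), d l ^ 2 =
      ∑ i ∈ Finset.range N, d ((i : ℤ) + 1) ^ 2 +
        ∑ i ∈ Finset.range N, mirror d ((i : ℤ) + 1) ^ 2 := by
  rw [sum_bonds, Finset.sum_add_distrib]
  congr 1
  refine Finset.sum_congr rfl fun i _ => ?_
  rw [mirror, show 1 - ((i : ℤ) + 1) = -i by ring]

theorem coercive_of_nonneg {N K : ℕ} (hK : 2 ≤ K) (hN : K + 2 ≤ N) (a : ℝ) {b : ℝ} (hb : 0 ≤ b)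
    (u : Disp N) : a * normU12 N u ^ 2 ≤ ip N (Lqce N K a b u) u := by
  have he := eps_pos (show 0 < N by omega)
  rw [ip_Lqce_self hK hN]
  have h1 := halfForm_le hK hN (strain N u)
  have h2 := halfForm_le hK hN (mirror (strain N u))
  have h3 := sum_sq_bonds N (strain N u)
  have h4 := normU12_sq (show 0 < N by omega) u
  rw [show mirror (strain N u) 1 = strain N u 0 by simp [mirror]] at h2
  have h5 : halfForm K (strain N u) + halfForm K (mirror (strain N u)) +
      (strain N u 1 - strain N u 0) ^ 2 ≤
      4 * ∑ l ∈ Finset.Icc (-(N : ℤ) + 1) (N : ℤ), strain N u l ^ 2 := by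
    rw [h3]
    nlinarith [sq_nonneg (strain N u 1 + strain N u 0)]
  have h6 := mul_le_mul_of_nonneg_left (mul_le_mul_of_nonneg_left h5 he.le) hb
  nlinarith

theorem neg_sq_le_ip {N K : ℕ} (hK : 2 ≤ K) (hN : K + 2 ≤ N) (u : Disp N) :
    -normU12 N u ^ 2 ≤ ip N (Lqce N K 4 (-1) u) u := by
  have he := eps_pos (show 0 < N by omega)
  rw [ip_Lqce_self hK hN]
  have h1 := neg_sum_le_halfForm hN (strain N u)
  have h2 := neg_sum_le_halfForm hN (mirror (strain N u))
  have h3 := sum_sq_bonds N (strain N u)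
  rw [normU12_sq (show 0 < N by omega), h3]
  nlinarith [sq_nonneg (strain N u 1 - strain N u 0)]

theorem qceStab_le_ip {N K : ℕ} (hK : 2 ≤ K) (hN : K + 2 ≤ N) (u : Disp N) :
    -lamK K * normU12 N u ^ 2 ≤ ip N (Lqce N K 4 (-1) u) u := by
  have hN0 : 0 < N := by omega
  by_cases hu : u = 0
  · subst hu
    simp [ip, normU12, strain]
  have hp := normU12_pos hN0 hu
  have hbdd : BddBelow {r : ℝ | ∃ N : ℕ, K + 2 ≤ N ∧ ∃ u : Disp N,
      normU12 N u = 1 ∧ r = ip N (Lqce N K 4 (-1) u) u} := by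
    refine ⟨-1, ?_⟩
    rintro r ⟨M, hM, v, hv, rfl⟩
    simpa [hv] using neg_sq_le_ip hK hM v
  have hmem : -lamK K ≤ ip N (Lqce N K 4 (-1) ((normU12 N u)⁻¹ • u))
      (((normU12 N u)⁻¹ • u : Disp N) : ℤ → ℝ) := by
    rw [lamK, neg_neg]
    refine csInf_le hbdd ⟨N, hN, (normU12 N u)⁻¹ • u, ?_, rfl⟩
    rw [Submodule.coe_smul, normU12_smul N (by positivity), inv_mul_cancel₀ hp.ne']
  rw [map_smul, Submodule.coe_smul, Submodule.coe_smul, ip_smul_smul] at hmem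
  calc _ ≤ ((normU12 N u)⁻¹ ^ 2 * ip N (Lqce N K 4 (-1) u) u) * normU12 N u ^ 2 :=
        mul_le_mul_of_nonneg_right hmem (sq_nonneg _)
    _ = _ := by field_simp

/-- The normalisation `A_F = 0`, `b = -1` isolates the part of the form that carries `b`;
multiplying that bound by `-b ≥ 0` and adding `A_F ‖u'‖²` gives the general case. -/
theorem coercive_of_nonpos {N K : ℕ} (hK : 2 ≤ K) (hN : K + 2 ≤ N) (a : ℝ) {b : ℝ} (hb : b ≤ 0)
    (u : Disp N) :
    (a + 4 * b + lamK K * b) * normU12 N u ^ 2 ≤ ip N (Lqce N K a b u) u := by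
  have h := qceStab_le_ip hK hN u
  rw [ip_Lqce_self hK hN] at h ⊢
  have := mul_le_mul_of_nonneg_left h (neg_nonneg.mpr hb)
  nlinarith

/-! ### Monotonicity of `λ_K` and uniform coercivity -/

/-- The antisymmetric displacement with prescribed values on the right half of the chain. -/
def oddDisp {N : ℕ} (E : ℕ → ℝ) (hE : ∀ n, N ≤ n → E n = 0) : Disp N :=
  ⟨fun j => if 0 ≤ j then E j.toNat else -E (-j).toNat, by
    intro j hj
    change (if 0 ≤ j then E j.toNat else -E (-j).toNat) = 0
    rcases abs_cases j with h | h
    · rw [if_pos h.2, hE _ (by omega)]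
    · rw [if_neg (by omega), hE _ (by omega), neg_zero]⟩

theorem strain_oddDisp {N : ℕ} (E : ℕ → ℝ) (hE : ∀ n, N ≤ n → E n = 0) (i : ℕ) :
    strain N (oddDisp E hE : Disp N) ((i : ℤ) + 1) = (E (i + 1) - E i) / eps N := by
  unfold strain oddDisp
  dsimp only
  rw [if_pos (by omega), if_pos (by omega), show ((i : ℤ) + 1).toNat = i + 1 by omega,
    show ((i : ℤ) + 1 - 1).toNat = i by omega]

theorem mirror_strain_oddDisp {N : ℕ} (E : ℕ → ℝ) (h0 : E 0 = 0) (hE : ∀ n, N ≤ n → E n = 0)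
    (i : ℕ) :
    mirror (strain N (oddDisp E hE : Disp N)) ((i : ℤ) + 1) = (E (i + 1) - E i) / eps N := by
  unfold mirror strain oddDisp
  dsimp only
  rw [if_neg (by omega : ¬ 0 ≤ 1 - ((i : ℤ) + 1) - 1),
    show (-(1 - ((i : ℤ) + 1) - 1)).toNat = i + 1 by omega]
  congr 1
  by_cases hi : i = 0
  · subst hi
    simp [h0]
  · rw [if_neg (by omega), show (-(1 - ((i : ℤ) + 1))).toNat = i by omega]
    ring

theorem halfForm_congr {K : ℕ} (hK : 2 ≤ K) {d e : ℤ → ℝ}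
    (h : ∀ i : ℕ, i < K + 2 → d ((i : ℤ) + 1) = e ((i : ℤ) + 1)) :
    halfForm K d = halfForm K e := by
  have h' : ∀ l : ℤ, 1 ≤ l → l ≤ K + 2 → d l = e l := by
    intro l h1 h2
    have := h (l - 1).toNat (by omega)
    rwa [show ((l - 1).toNat : ℤ) + 1 = l by omega] at this
  unfold halfForm
  rw [h' K (by omega) (by omega), h' (K + 1) (by omega) (by omega), h' (K + 2) (by omega) le_rfl]
  congr 4
  refine Finset.sum_congr rfl fun i hi => ?_
  have := Finset.mem_range.mp hi
  rw [h' (i + 2) (by omega) (by omega), h' (i + 1) (by omega) (by omega)]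

/-- The number `-λ_K` bounds the half-chain form from below: the strain is extended by a constant
of mean zero over a continuum region of `m` bonds, with `m → ∞`. -/
theorem neg_lamK_mul_le_halfForm {K : ℕ} (hK : 2 ≤ K) (r : ℤ → ℝ) :
    -lamK K * ∑ i ∈ Finset.range (K + 2), r ((i : ℤ) + 1) ^ 2 ≤ halfForm K r := by
  set R := ∑ i ∈ Finset.range (K + 2), r ((i : ℤ) + 1) ^ 2 with hR
  set s := ∑ i ∈ Finset.range (K + 2), r ((i : ℤ) + 1) with hs
  have key : ∀ m : ℕ, -lamK K * (R + s ^ 2 * (1 / ((m : ℝ) + 1))) ≤ halfForm K r := by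
    intro m
    set N := K + 2 + (m + 1) with hN
    have he := eps_pos (show 0 < N by omega)
    have hm : (0 : ℝ) < (m : ℝ) + 1 := by positivity
    -- The value `-s / (m + 1)` on `m + 1` continuum bonds makes the total strain zero. It leaves
    -- `halfForm` unchanged and adds only `s² / (m + 1)` to the sum of squares.
    set e : ℕ → ℝ := fun i => if i < K + 2 then r ((i : ℤ) + 1)
      else if i < N then -s / ((m : ℝ) + 1) else 0 with hedef
    have e1 : ∀ i, i < K + 2 → e i = r ((i : ℤ) + 1) := fun i hi => if_pos hi
    have e2 : ∀ i, i < m + 1 → e (K + 2 + i) = -s / ((m : ℝ) + 1) := fun i hi => by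
      simp only [hedef]
      rw [if_neg (by omega), if_pos (by omega)]
    have e3 : ∀ i, e (N + i) = 0 := fun i => by
      simp only [hedef]
      rw [if_neg (by omega), if_neg (by omega)]
    set E : ℕ → ℝ := fun n => eps N * ∑ i ∈ Finset.range n, e i with hEdef
    have hsum : ∑ i ∈ Finset.range N, e i = 0 := by
      rw [hN, Finset.sum_range_add, Finset.sum_congr rfl fun i hi => e1 i (Finset.mem_range.mp hi),
        Finset.sum_congr rfl fun i hi => e2 i (Finset.mem_range.mp hi), Finset.sum_const,
        Finset.card_range, nsmul_eq_mul, ← hs]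
      push_cast
      field_simp
      ring
    have hE : ∀ n, N ≤ n → E n = 0 := by
      intro n hn
      obtain ⟨k, rfl⟩ := Nat.exists_eq_add_of_le hn
      simp only [hEdef]
      rw [Finset.sum_range_add, hsum, Finset.sum_congr rfl fun i _ => e3 i]
      simp
    have hdiff : ∀ i, (E (i + 1) - E i) / eps N = e i := by
      intro i
      simp only [hEdef]
      rw [Finset.sum_range_succ]
      field_simp
      ring
    -- For an odd displacement both halves carry the same strain, so the central term vanishes and
    -- everything else doubles.
    set u : Disp N := oddDisp E hE with hu
    have s1 : ∀ i : ℕ, strain N u ((i : ℤ) + 1) = e i := fun i => by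
      rw [hu, strain_oddDisp, hdiff]
    have s2 : ∀ i : ℕ, mirror (strain N u) ((i : ℤ) + 1) = e i := fun i => by
      rw [hu, mirror_strain_oddDisp _ (by simp [hEdef]), hdiff]
    have h := qceStab_le_ip hK (show K + 2 ≤ N by omega) u
    have t1 := s1 0
    have t2 := s2 0
    simp only [mirror, Nat.cast_zero, zero_add, sub_self] at t1 t2
    rw [ip_Lqce_self hK (by omega), normU12_sq (by omega), sum_sq_bonds,
      halfForm_congr hK fun i hi => (s1 i).trans (e1 i hi),
      halfForm_congr hK fun i hi => (s2 i).trans (e1 i hi), t1, t2] at h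
    simp only [s1, s2] at h
    have hq : ∑ i ∈ Finset.range N, e i ^ 2 = R + s ^ 2 * (1 / ((m : ℝ) + 1)) := by
      have q1 : ∑ i ∈ Finset.range (K + 2), e i ^ 2 = R :=
        Finset.sum_congr rfl fun i hi => by rw [e1 i (Finset.mem_range.mp hi)]
      have q2 : ∑ i ∈ Finset.range (m + 1), e (K + 2 + i) ^ 2 =
          ∑ i ∈ Finset.range (m + 1), (-s / ((m : ℝ) + 1)) ^ 2 :=
        Finset.sum_congr rfl fun i hi => by rw [e2 i (Finset.mem_range.mp hi)]
      rw [hN, Finset.sum_range_add, q1, q2, Finset.sum_const, Finset.card_range, nsmul_eq_mul]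
      push_cast
      field_simp
    rw [hq] at h
    have h' : eps N * (2 * (-lamK K * (R + s ^ 2 * (1 / ((m : ℝ) + 1))))) ≤
        eps N * (2 * halfForm K r) := by
      nlinarith
    have := le_of_mul_le_mul_left h' he
    linarith
  have lim : Filter.Tendsto (fun m : ℕ => -lamK K * (R + s ^ 2 * (1 / ((m : ℝ) + 1))))
      Filter.atTop (nhds (-lamK K * (R + s ^ 2 * 0))) :=
    ((tendsto_one_div_add_atTop_nhds_zero_nat.const_mul _).const_add _).const_mul _
  rw [mul_zero, add_zero] at lim
  exact le_of_tendsto' lim key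

/-- A unit strain on bond `K + 2` alone gives `1/2 - 1 = -1/2`. Only the sign of `lamK K` matters
afterwards. -/
theorem half_le_lamK {K : ℕ} (hK : 2 ≤ K) : 1 / 2 ≤ lamK K := by
  have h := neg_lamK_mul_le_halfForm hK (fun l => if l = (K : ℤ) + 2 then 1 else 0)
  have e1 : ∑ i ∈ Finset.range (K + 2),
      (if ((i : ℤ) + 1) = (K : ℤ) + 2 then (1 : ℝ) else 0) ^ 2 = 1 := by
    rw [Finset.sum_eq_single (K + 1)]
    · rw [if_pos (by push_cast; ring)]; norm_num
    · intro i _ hi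
      rw [if_neg (by omega)]; norm_num
    · simp
  have e2 : halfForm K (fun l => if l = (K : ℤ) + 2 then 1 else 0) = -(1 / 2) := by
    unfold halfForm
    rw [Finset.sum_eq_zero]
    · norm_num
    · intro i hi
      have := Finset.mem_range.mp hi
      dsimp only
      rw [if_neg (by omega), if_neg (by omega)]
      norm_num
  rw [e1, e2] at h
  linarith

/-- In each half, deleting the first bond turns the form for `K + 1` into one for `K` that is no
larger. The shortened strain need no longer have mean zero, which is why the bound for arbitrary
half-chain strains is required. -/
theorem lamK_succ_le {K : ℕ} (hK : 2 ≤ K) : lamK (K + 1) ≤ lamK K := by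
  have hl := half_le_lamK hK
  rw [lamK, neg_le]
  -- The second argument, `-lamK K ≤ 0`, covers the convention that `sInf ∅ = 0`.
  refine Real.le_sInf ?_ (by linarith)
  rintro r ⟨N, hN, u, hu, rfl⟩
  have he := eps_pos (show 0 < N by omega)
  have half : ∀ d : ℤ → ℝ, -lamK K * ∑ i ∈ Finset.range N, d ((i : ℤ) + 1) ^ 2 ≤
      halfForm (K + 1) d := by
    intro d
    have h1 := halfForm_shift_le hK d
    have h2 := neg_lamK_mul_le_halfForm hK (fun l => d (l + 1))
    have h3 : ∑ i ∈ Finset.range (K + 3), d ((i : ℤ) + 1) ^ 2 ≤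
        ∑ i ∈ Finset.range N, d ((i : ℤ) + 1) ^ 2 :=
      Finset.sum_le_sum_of_subset_of_nonneg (Finset.range_mono (by omega))
        fun _ _ _ => sq_nonneg _
    rw [Finset.sum_range_succ'] at h3
    push_cast at h3
    nlinarith [sq_nonneg (d (0 + 1))]
  have h1 := half (strain N u)
  have h2 := half (mirror (strain N u))
  have h3 := normU12_sq (show 0 < N by omega) u
  rw [sum_sq_bonds, hu] at h3
  rw [ip_Lqce_self (by omega) hN, hu]
  nlinarith [sq_nonneg (strain N u 1 - strain N u 0)]

theorem lamK_antitone {J K : ℕ} (hJ : 2 ≤ J) (hJK : J ≤ K) : lamK K ≤ lamK J := by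
  induction K, hJK using Nat.le_induction with
  | base => exact le_rfl
  | succ n hn ih => exact (lamK_succ_le (hJ.trans hn)).trans ih

/-- Coercivity of the energy-based operator, uniformly in the width of the atomistic region. -/
theorem exists_uniform_coercivity {a : ℝ} (b : ℝ) (ha : 0 < a) :
    ∃ c : ℝ, 0 < c ∧ ∀ N K : ℕ, 2 ≤ K → K + 2 ≤ N → 0 < (a + 4 * b) + lamK K * b →
      ∀ u : Disp N, c * normU12 N u ^ 2 ≤ ip N (Lqce N K a b u) u := by
  rcases le_total 0 b with hb | hb
  · exact ⟨a, ha, fun N K hK hN _ u => coercive_of_nonneg hK hN a hb u⟩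
  by_cases hex : ∃ K, 2 ≤ K ∧ 0 < (a + 4 * b) + lamK K * b
  · classical
    -- The constant is `A_F + λ_J b` for the least admissible `J`: it depends on `a` and `b` only,
    -- and for `b ≤ 0` antitonicity of `lamK` makes it the smallest over all admissible `K`.
    have hJ := Nat.find_spec hex
    refine ⟨_, hJ.2, fun N K hK hN hpos u => ?_⟩
    have hle := lamK_antitone hJ.1 (Nat.find_min' hex ⟨hK, hpos⟩)
    refine le_trans ?_ (coercive_of_nonpos hK hN a hb u)
    exact mul_le_mul_of_nonneg_right
      (by linarith [mul_le_mul_of_nonpos_right hle hb]) (sq_nonneg _)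
  · exact ⟨1, one_pos, fun N K hK _ hpos => absurd ⟨K, hK, hpos⟩ hex⟩

/-! ### Invertibility and the equation for `G v` -/

/-- In finite dimension the injectivity provided by coercivity already makes `Lqce` a unit. -/
instance finiteDimensional_disp (N : ℕ) : FiniteDimensional ℝ (Disp N) := by
  let φ : Disp N →ₗ[ℝ] (Fin (2 * N + 1) → ℝ) :=
    { toFun := fun u i => (u : ℤ → ℝ) ((i : ℤ) - N)
      map_add' := fun _ _ => rfl
      map_smul' := fun _ _ => rfl }
  refine FiniteDimensional.of_injective φ fun u v h => ?_
  ext j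
  by_cases hj : (N : ℤ) ≤ |j|
  · rw [disp_eq_zero u hj, disp_eq_zero v hj]
  · rw [not_le, abs_lt] at hj
    have := congrFun h ⟨(j + N).toNat, by omega⟩
    change (u : ℤ → ℝ) (((j + N).toNat : ℤ) - N) = (v : ℤ → ℝ) (((j + N).toNat : ℤ) - N) at this
    rwa [show ((j + N).toNat : ℤ) - N = j by omega] at this

theorem isUnit_Lqce_of_coercive {N K : ℕ} (hN : 0 < N) {a b c : ℝ} (hc : 0 < c)
    (h : ∀ u : Disp N, c * normU12 N u ^ 2 ≤ ip N (Lqce N K a b u) u) :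
    IsUnit (Lqce N K a b) := by
  rw [LinearMap.isUnit_iff_ker_eq_bot, LinearMap.ker_eq_bot']
  intro u hu
  have h1 := h u
  rw [hu] at h1
  apply eq_zero_of_normU12 hN
  have h2 : normU12 N u ^ 2 ≤ 0 := by
    have : ip N ((0 : Disp N) : ℤ → ℝ) u = 0 := by simp [ip]
    rw [this] at h1
    by_contra! h3
    nlinarith [mul_pos hc h3]
  exact pow_eq_zero_iff two_ne_zero |>.mp (le_antisymm h2 (sq_nonneg _))

/-- This removes the inverse: `G v` is characterised by an equation whose right-hand side is
explicit and local. -/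
theorem Lqce_Gqce {N K : ℕ} {a b : ℝ} (h : IsUnit (Lqce N K a b)) (v : Disp N) :
    Lqce N K a b (Gqce N K a b v) = Lqce N K a b v - Lqcf N K a b v := by
  have hx := LinearMap.congr_fun (Ring.mul_inverse_cancel _ h) (Lqcf N K a b v)
  rw [Module.End.mul_apply, Module.End.one_apply] at hx
  change Lqce N K a b (v - Ring.inverse (Lqce N K a b) (Lqcf N K a b v)) = _
  rw [map_sub, hx]

/-! ### The interface residual and the upper bound -/

/-- The rows of `L^{qce} - L^{qcf}` in the right half of the chain, up to the factor `φ''_{2F} / ε`,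
as a function of the strain `d`. -/
def interfaceRow (K : ℕ) (d : ℤ → ℝ) (j : ℤ) : ℝ :=
  if j = (K : ℤ) - 1 then (d K + d (K + 1)) / 2
  else if j = (K : ℤ) then (d (K + 2) - 3 * d (K + 1)) / 2
  else if j = (K : ℤ) + 1 then (d K - 3 * d (K + 1)) / 2
  else if j = (K : ℤ) + 2 then (d (K + 1) + d (K + 2)) / 2
  else 0

theorem interfaceRow_eq_zero {K : ℕ} (d : ℤ → ℝ) {j : ℤ}
    (hj : j ∉ Finset.Icc ((K : ℤ) - 1) ((K : ℤ) + 2)) : interfaceRow K d j = 0 := by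
  rw [Finset.mem_Icc] at hj
  unfold interfaceRow
  rw [if_neg (by omega), if_neg (by omega), if_neg (by omega), if_neg (by omega)]

theorem abs_interfaceRow_le (K : ℕ) {d : ℤ → ℝ} {M : ℝ} (hd : ∀ l, |d l| ≤ M) (j : ℤ) :
    |interfaceRow K d j| ≤ 2 * M := by
  have h0 := abs_le.mp (hd K)
  have h1 := abs_le.mp (hd (K + 1))
  have h2 := abs_le.mp (hd (K + 2))
  rw [abs_le]
  unfold interfaceRow
  split_ifs <;> constructor <;> linarith

theorem qceHalfRow_sub_qcfRow {N K : ℕ} (hN : 0 < N) (a b : ℝ) (v : ℤ → ℝ) {j : ℤ} (hj : 0 ≤ j) :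
    qceHalfRow N K a b v j - qcfRow N K a b v j = b / eps N * interfaceRow K (strain N v) j := by
  have he := (eps_pos hN).ne'
  unfold qceHalfRow qcfRow interfaceRow atRow qclRow
  rw [abs_of_nonneg hj]
  by_cases h0 : j ≤ (K : ℤ) - 2
  · rw [if_pos h0, if_pos (by omega), if_neg (by omega), if_neg (by omega), if_neg (by omega),
      if_neg (by omega)]
    ring
  rw [if_neg h0]
  by_cases h1 : j = (K : ℤ) - 1
  · subst h1
    rw [if_pos rfl, if_pos (by omega), if_pos rfl]
    unfold strain
    rw [show (K : ℤ) - 1 + 2 = K + 1 by ring, show (K : ℤ) + 1 - 1 = K by ring]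
    field_simp
    ring
  rw [if_neg h1, if_neg h1]
  by_cases h2 : j = (K : ℤ)
  · subst h2
    rw [if_pos rfl, if_pos le_rfl, if_pos rfl]
    unfold strain
    rw [show (K : ℤ) + 2 - 1 = K + 1 by ring, show (K : ℤ) + 1 - 1 = K by ring]
    field_simp
    ring
  rw [if_neg h2, if_neg h2, if_neg (by omega : ¬ j ≤ (K : ℤ))]
  by_cases h3 : j = (K : ℤ) + 1
  · subst h3
    rw [if_pos rfl, if_pos rfl]
    unfold strain
    rw [show (K : ℤ) + 1 - 1 = K by ring, show (K : ℤ) + 1 - 2 = K - 1 by ring]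
    field_simp
    ring
  rw [if_neg h3, if_neg h3]
  by_cases h4 : j = (K : ℤ) + 2
  · subst h4
    rw [if_pos rfl, if_pos rfl]
    unfold strain
    rw [show (K : ℤ) + 2 - 1 = K + 1 by ring, show (K : ℤ) + 1 - 1 = K by ring,
      show (K : ℤ) + 2 - 2 = K by ring]
    field_simp
    ring
  rw [if_neg h4, if_neg h4]
  ring

theorem qcfRow_reflect (N K : ℕ) (a b : ℝ) (v : ℤ → ℝ) (j : ℤ) :
    qcfRow N K a b v j = qcfRow N K a b (fun i => v (-i)) (-j) := by
  simp only [qcfRow, atRow, qclRow, lap1, lap2, abs_neg, neg_neg]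
  rw [show -(-j + 1) = j - 1 by ring, show -(-j - 1) = j + 1 by ring,
    show -(-j + 2) = j - 2 by ring, show -(-j - 2) = j + 2 by ring]
  split_ifs <;> ring

/-- The rows of `L^{qce} - L^{qcf}`. -/
theorem Lqce_sub_Lqcf_apply {N K : ℕ} (hN : 0 < N) (a b : ℝ) (v : Disp N) (j : ℤ) :
    ((Lqce N K a b v - Lqcf N K a b v : Disp N) : ℤ → ℝ) j =
      if |j| < (N : ℤ) then b / eps N * (if 0 ≤ j then interfaceRow K (strain N v) j
        else interfaceRow K (fun l => -mirror (strain N v) l) (-j)) else 0 := by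
  change (if |j| < (N : ℤ) then qceRow N K a b (v : ℤ → ℝ) j else 0) -
    (if |j| < (N : ℤ) then qcfRow N K a b (v : ℤ → ℝ) j else 0) = _
  by_cases h : |j| < (N : ℤ)
  · rw [if_pos h, if_pos h, if_pos h]
    unfold qceRow
    by_cases hj : 0 ≤ j
    · rw [if_pos hj, if_pos hj, qceHalfRow_sub_qcfRow hN _ _ _ hj]
    · rw [if_neg hj, if_neg hj, qcfRow_reflect, qceHalfRow_sub_qcfRow hN _ _ _ (by omega)]
      congr 2
      exact funext (strain_reflect N v)
  · rw [if_neg h, if_neg h, if_neg h, sub_zero]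

theorem eps_inv (N : ℕ) : (eps N)⁻¹ = N := by simp [eps]

/-- One bond carries weight `ε` in the squared norm, so a single strain may exceed the norm by
`ε^{-1/2} = √N`. This is the whole growth in the upper bound. -/
theorem abs_strain_le {N : ℕ} (hN : 0 < N) (v : Disp N) (l : ℤ) :
    |strain N v l| ≤ Real.sqrt N * normU12 N v := by
  have he := eps_pos hN
  have hn := mul_nonneg (Real.sqrt_nonneg (N : ℝ)) (normU12_nonneg N v)
  by_cases hl : l ∈ Finset.Icc (-(N : ℤ) + 1) (N : ℤ)
  · apply abs_le_of_sq_le_sq _ hn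
    rw [mul_pow, Real.sq_sqrt (by positivity), normU12_sq hN, ← mul_assoc, ← eps_inv,
      inv_mul_cancel₀ he.ne', one_mul]
    exact Finset.single_le_sum (f := fun l => strain N v l ^ 2) (fun _ _ => sq_nonneg _) hl
  · rw [Finset.mem_Icc] at hl
    have h1 : (N : ℤ) ≤ |l| := by rcases abs_cases l with h | h <;> omega
    have h2 : (N : ℤ) ≤ |l - 1| := by rcases abs_cases (l - 1) with h | h <;> omega
    rw [strain, disp_eq_zero v h1, disp_eq_zero v h2]
    simpa using hn

/-- The residual of the force-based operator is concentrated at the two interfaces. -/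
theorem abs_ip_residual_le {N K : ℕ} (hN : 0 < N) (a b : ℝ) (v g : Disp N) :
    |ip N (Lqce N K a b v - Lqcf N K a b v : Disp N) g| ≤
      16 * Real.sqrt 2 * |b| * Real.sqrt N * normU12 N v * normU12 N g := by
  have he := eps_pos hN
  set f : ℤ → ℝ := ((Lqce N K a b v - Lqcf N K a b v : Disp N) : ℤ → ℝ) with hf
  set M := Real.sqrt N * normU12 N v with hM
  have hM0 : 0 ≤ M := mul_nonneg (Real.sqrt_nonneg _) (normU12_nonneg N v)
  set T : Finset ℤ := Finset.Icc ((K : ℤ) - 1) ((K : ℤ) + 2) ∪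
    Finset.Icc (-((K : ℤ) + 2)) (-((K : ℤ) - 1)) with hT
  -- Each of at most 8 atoms contributes at most `B`; the weight `ε` of the inner product cancels
  -- the `1/ε` in `B`, leaving `8 · 2 · √2 = 16 √2`.
  set B := |b| / eps N * (2 * M) * (Real.sqrt 2 * normU12 N g) with hB
  have hB0 : 0 ≤ B := by
    have := normU12_nonneg N g
    positivity
  have hcard : (T.card : ℝ) ≤ 8 := by
    have h1 := Finset.card_union_le (Finset.Icc ((K : ℤ) - 1) ((K : ℤ) + 2))
      (Finset.Icc (-((K : ℤ) + 2)) (-((K : ℤ) - 1)))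
    rw [Int.card_Icc, Int.card_Icc] at h1
    have h2 : T.card ≤ 8 := by rw [hT]; omega
    exact_mod_cast h2
  have hfT : ∀ l, |f l * (g : ℤ → ℝ) l| ≤ if l ∈ T then B else 0 := by
    intro l
    rw [hf, Lqce_sub_Lqcf_apply hN]
    split_ifs with h1 h2 h3 h3
    · rw [abs_mul, abs_mul, abs_div, abs_of_pos he]
      exact mul_le_mul (mul_le_mul_of_nonneg_left
        (abs_interfaceRow_le K (abs_strain_le hN v) l) (by positivity))
        (abs_le_normU12 hN g l) (abs_nonneg _) (by positivity)
    · rw [interfaceRow_eq_zero _ fun h => h3 (Finset.mem_union_left _ h)]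
      simp
    · rw [abs_mul, abs_mul, abs_div, abs_of_pos he]
      refine mul_le_mul (mul_le_mul_of_nonneg_left
        (abs_interfaceRow_le K (fun i => ?_) (-l)) (by positivity))
        (abs_le_normU12 hN g l) (abs_nonneg _) (by positivity)
      rw [abs_neg]
      exact abs_strain_le hN v _
    · rw [interfaceRow_eq_zero _ fun h => h3 (Finset.mem_union_right _ ?_)]
      · simp
      · rw [Finset.mem_Icc] at h ⊢
        omega
    · simpa using hB0
    · simp
  unfold ip
  rw [abs_mul, abs_of_pos he]
  calc _ ≤ eps N * ∑ l ∈ Finset.Icc (-(N : ℤ) + 1) (N : ℤ), if l ∈ T then B else 0 :=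
        mul_le_mul_of_nonneg_left ((Finset.abs_sum_le_sum_abs _ _).trans
          (Finset.sum_le_sum fun l _ => hfT l)) he.le
    _ ≤ eps N * (8 * B) := by
        rw [Finset.sum_ite_mem, Finset.sum_const, nsmul_eq_mul]
        refine mul_le_mul_of_nonneg_left (mul_le_mul_of_nonneg_right ?_ hB0) he.le
        exact le_trans (Nat.cast_le.mpr (Finset.card_le_card Finset.inter_subset_right)) hcard
    _ = _ := by
        rw [hB, hM]
        field_simp
        ring

/-- Test the equation for `g = G v` with `g` itself, bound the left side below by coercivity, and
divide by `‖g‖`. -/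
theorem normU12_Gqce_le {N K : ℕ} (hN : 0 < N) {a b c : ℝ} (hc : 0 < c)
    (h : ∀ u : Disp N, c * normU12 N u ^ 2 ≤ ip N (Lqce N K a b u) u) (v : Disp N) :
    normU12 N (Gqce N K a b v) ≤
      16 * Real.sqrt 2 * |b| / c * Real.sqrt N * normU12 N v := by
  have h1 := h (Gqce N K a b v)
  rw [Lqce_Gqce (isUnit_Lqce_of_coercive hN hc h)] at h1
  have h2 := h1.trans ((le_abs_self _).trans (abs_ip_residual_le hN a b v (Gqce N K a b v)))
  have hv := normU12_nonneg N v
  rcases (normU12_nonneg N (Gqce N K a b v)).eq_or_lt with h0 | h0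
  · rw [← h0]; positivity
  · rw [sq, ← mul_assoc] at h2
    have h3 := le_of_mul_le_mul_right h2 h0
    rw [← mul_le_mul_iff_right₀ hc]
    calc _ ≤ _ := h3
      _ = _ := by field_simp

/-! ### Bump, plateau and the lower bound -/

/-- A displacement whose strain is concentrated at the right interface. -/
def bump {N K : ℕ} (hN : K + 2 ≤ N) : Disp N :=
  ⟨fun j => if j = (K : ℤ) then -1 else if j = (K : ℤ) + 1 then 1 else 0, by
    intro j hj
    change (if j = (K : ℤ) then (-1 : ℝ) else if j = (K : ℤ) + 1 then 1 else 0) = 0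
    rw [if_neg, if_neg]
    · rintro rfl
      rw [abs_of_nonneg (by omega)] at hj
      omega
    · rintro rfl
      rw [abs_of_nonneg (by omega)] at hj
      omega⟩

theorem strain_bump {N K : ℕ} (hN : K + 2 ≤ N) (l : ℤ) :
    strain N (bump hN : Disp N) l = N * (if l = (K : ℤ) then -1 else
      if l = (K : ℤ) + 1 then 2 else if l = (K : ℤ) + 2 then -1 else 0) := by
  unfold strain bump
  rw [div_eq_mul_inv, eps_inv, mul_comm]
  congr 1
  dsimp only
  split_ifs <;> first | omega | norm_num

theorem normU12_bump_sq {N K : ℕ} (hN : K + 2 ≤ N) :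
    normU12 N (bump hN : Disp N) ^ 2 = 6 * N := by
  have hN0 : (N : ℝ) ≠ 0 := by
    have : N ≠ 0 := by omega
    exact_mod_cast this
  rw [normU12_sq (by omega)]
  have hsub : ({(K : ℤ), (K : ℤ) + 1, (K : ℤ) + 2} : Finset ℤ) ⊆
      Finset.Icc (-(N : ℤ) + 1) (N : ℤ) := by
    intro x hx
    simp only [Finset.mem_insert, Finset.mem_singleton] at hx
    rw [Finset.mem_Icc]
    omega
  rw [← Finset.sum_subset hsub, Finset.sum_insert (by simp), Finset.sum_insert (by simp),
    Finset.sum_singleton, strain_bump, strain_bump, strain_bump]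
  · unfold eps
    norm_num
    field_simp
    norm_num
  · intro x _ hx
    simp only [Finset.mem_insert, Finset.mem_singleton, not_or] at hx
    rw [strain_bump, if_neg hx.1, if_neg hx.2.1, if_neg hx.2.2]
    simp

/-- The integer heights of a plateau that is constant on the atomistic region and decays linearly
to the ends of the chain. -/
def plateauHeight (N K : ℕ) (j : ℤ) : ℤ := max 0 (min ((N : ℤ) - |j|) ((N : ℤ) - K - 2))

/-- A displacement that is constant on the atomistic region and linear outside. -/
def plateau (N K : ℕ) : Disp N :=
  ⟨fun j => (plateauHeight N K j : ℝ) / N, by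
    intro j hj
    have : plateauHeight N K j = 0 := by unfold plateauHeight; omega
    change (plateauHeight N K j : ℝ) / N = 0
    rw [this]
    simp⟩

theorem plateau_apply {N K : ℕ} (hN : K + 2 ≤ N) {j : ℤ} (hj : |j| ≤ (K : ℤ) + 2) :
    (plateau N K : ℤ → ℝ) j = ((N : ℝ) - K - 2) / N := by
  have : plateauHeight N K j = (N : ℤ) - K - 2 := by unfold plateauHeight; omega
  change (plateauHeight N K j : ℝ) / N = _
  rw [this]
  push_cast
  rfl

theorem strain_plateau {N K : ℕ} (hN : 0 < N) (l : ℤ) :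
    strain N (plateau N K) l = ((plateauHeight N K l - plateauHeight N K (l - 1) : ℤ) : ℝ) := by
  have : (N : ℝ) ≠ 0 := by positivity
  change ((plateauHeight N K l : ℝ) / N - (plateauHeight N K (l - 1) : ℝ) / N) / (1 / N) = _
  push_cast
  field_simp

theorem abs_strain_plateau_le {N K : ℕ} (hN : 0 < N) (l : ℤ) :
    |strain N (plateau N K) l| ≤ 1 := by
  rw [strain_plateau hN, ← Int.cast_abs]
  have : |plateauHeight N K l - plateauHeight N K (l - 1)| ≤ 1 := by
    unfold plateauHeight
    have h1 := abs_cases l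
    have h2 := abs_cases (l - 1)
    rw [abs_le]
    omega
  exact_mod_cast this

/-- The plateau reaches out to atoms `±(K + 2)` so that it is flat on every bond where the
energy-based stress differs from the local one, and takes one value on all atoms that carry the
residual. -/
theorem strain_plateau_eq_zero {N K : ℕ} (hN : K + 2 ≤ N) {l : ℤ} (h1 : -(K : ℤ) - 1 ≤ l)
    (h2 : l ≤ (K : ℤ) + 2) : strain N (plateau N K) l = 0 := by
  have e1 : |l| ≤ (K : ℤ) + 2 := abs_le.mpr (by omega)
  have e2 : |l - 1| ≤ (K : ℤ) + 2 := abs_le.mpr (by omega)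
  rw [strain, plateau_apply hN e1, plateau_apply hN e2, sub_self, zero_div]

theorem normU12_plateau_sq_le {N K : ℕ} (hN : 0 < N) : normU12 N (plateau N K) ^ 2 ≤ 2 := by
  rw [normU12_sq hN, sum_bonds]
  have h : ∀ l : ℤ, strain N (plateau N K) l ^ 2 ≤ 1 := fun l =>
    (sq_le_one_iff_abs_le_one _).mpr (abs_strain_plateau_le hN l)
  have hs := Finset.sum_le_card_nsmul (Finset.range N) (fun i : ℕ =>
    strain N (plateau N K) ((i : ℤ) + 1) ^ 2 + strain N (plateau N K) (-(i : ℤ)) ^ 2) 2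
    fun i _ => by linarith [h ((i : ℤ) + 1), h (-(i : ℤ))]
  rw [Finset.card_range, nsmul_eq_mul] at hs
  have he := eps_pos hN
  have : (N : ℝ) ≠ 0 := by positivity
  calc _ ≤ eps N * (N * 2) := mul_le_mul_of_nonneg_left hs he.le
    _ = 2 := by unfold eps; field_simp

theorem flux_of_far {K : ℕ} (d : ℤ → ℝ) {l : ℤ} (h : ¬ (-(K : ℤ) - 1 ≤ l ∧ l ≤ (K : ℤ) + 2)) :
    flux K d l = 4 * d l := by
  unfold flux halfFlux mirror
  split_ifs <;> first | omega | rfl | rw [sub_sub_cancel]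

/-- Tested against the plateau, the energy-based operator acts as the local one. -/
theorem abs_ip_Lqce_plateau_le {N K : ℕ} (hK : 2 ≤ K) (hN : K + 2 ≤ N) (a b : ℝ) (g : Disp N) :
    |ip N (Lqce N K a b g) (plateau N K)| ≤
      |a + 4 * b| * (normU12 N g * normU12 N (plateau N K)) := by
  have hN0 : 0 < N := by omega
  rw [ip_Lqce hN0 hK]
  have e : ∑ l ∈ Finset.Icc (-(N : ℤ) + 1) (N : ℤ),
      stress K a b (strain N g) l * strain N (plateau N K) l = (a + 4 * b) *
      ∑ l ∈ Finset.Icc (-(N : ℤ) + 1) (N : ℤ), strain N g l * strain N (plateau N K) l := by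
    rw [Finset.mul_sum]
    refine Finset.sum_congr rfl fun l _ => ?_
    by_cases h : -(K : ℤ) - 1 ≤ l ∧ l ≤ (K : ℤ) + 2
    · rw [strain_plateau_eq_zero hN h.1 h.2]; ring
    · unfold stress
      rw [flux_of_far _ h]
      ring
  rw [e, mul_left_comm, abs_mul]
  exact mul_le_mul_of_nonneg_left (abs_sum_strain_le hN0 _ _) (abs_nonneg _)

/-- The residual of the bump exerts a net force on the interface. -/
theorem ip_residual_bump {N K : ℕ} (hK : 2 ≤ K) (hN : K + 2 < N) (a b : ℝ) :
    ip N (Lqce N K a b (bump hN.le) - Lqcf N K a b (bump hN.le) : Disp N) (plateau N K) =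
      -6 * b * ((N : ℝ) - K - 2) := by
  have hN0 : (N : ℝ) ≠ 0 := by
    have : N ≠ 0 := by omega
    exact_mod_cast this
  unfold ip
  have hsub : ({(K : ℤ) - 1, (K : ℤ), (K : ℤ) + 1, (K : ℤ) + 2} : Finset ℤ) ⊆
      Finset.Icc (-(N : ℤ) + 1) (N : ℤ) := by
    intro x hx
    simp only [Finset.mem_insert, Finset.mem_singleton] at hx
    rw [Finset.mem_Icc]
    omega
  have hval : ∀ j : ℤ, 0 ≤ j → j ≤ (K : ℤ) + 2 →
      ((Lqce N K a b (bump hN.le) - Lqcf N K a b (bump hN.le) : Disp N) : ℤ → ℝ) j *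
        (plateau N K : ℤ → ℝ) j = b * N * interfaceRow K (strain N (bump hN.le : Disp N)) j *
          (((N : ℝ) - K - 2) / N) := by
    intro j h1 h2
    -- The strict inequality `K + 2 < N` makes atom `K + 2` free, so no interface row is lost to the
    -- clamping.
    rw [Lqce_sub_Lqcf_apply (by omega), if_pos (by rw [abs_of_nonneg h1]; omega), if_pos h1,
      plateau_apply hN.le (by rw [abs_of_nonneg h1]; exact h2), div_eq_mul_inv b, eps_inv]
  have d0 : strain N (bump hN.le : Disp N) (K : ℤ) = -N := by rw [strain_bump]; simp
  have d1 : strain N (bump hN.le : Disp N) ((K : ℤ) + 1) = 2 * N := by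
    rw [strain_bump]; simp; ring
  have d2 : strain N (bump hN.le : Disp N) ((K : ℤ) + 2) = -N := by rw [strain_bump]; simp
  rw [← Finset.sum_subset hsub, Finset.sum_insert (by simp; omega), Finset.sum_insert (by simp),
    Finset.sum_insert (by simp), Finset.sum_singleton, hval _ (by omega) (by omega),
    hval _ (by omega) (by omega), hval _ (by omega) (by omega), hval _ (by omega) le_rfl]
  -- The four rows add up to `d_K - 2 d_{K+1} + d_{K+2} = -6N`.
  · unfold interfaceRow
    rw [d0, d1, d2]
    norm_num
    rw [if_neg (by omega), if_neg (by omega), if_neg (by omega)]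
    unfold eps
    field_simp
    ring
  · intro x _ hx
    simp only [Finset.mem_insert, Finset.mem_singleton, not_or] at hx
    rw [Lqce_sub_Lqcf_apply (by omega)]
    split_ifs with h1 h2
    · rw [interfaceRow_eq_zero]
      · simp
      · rw [Finset.mem_Icc]; omega
    -- The left interface is at rest: its bonds have index at most `1 - K < 0`, and the bump strains
    -- only bonds `K`, `K + 1`, `K + 2`.
    · have : ∀ i : ℤ, (K : ℤ) ≤ i → -mirror (strain N (bump hN.le : Disp N)) i = 0 := by
        intro i hi
        rw [mirror, strain_bump, if_neg (by omega), if_neg (by omega), if_neg (by omega)]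
        simp
      simp only [interfaceRow]
      rw [this K le_rfl, this (K + 1) (by omega), this (K + 2) (by omega)]
      simp
    · simp

/-- Testing with the plateau gives `6 |b| (N - K - 2) ≤ |A_F| ‖g‖ ‖plateau‖`, whose left side is of
order `N`, against a bump of norm of order `√N`. The `+ 1` keeps the denominator positive without
any assumption on `a + 4 * b`. -/
theorem le_normU12_Gqce_bump {N K : ℕ} (hK : 2 ≤ K) (hN : 8 ≤ N) (hKN : 2 * K ≤ N) {a b : ℝ}
    (h : IsUnit (Lqce N K a b)) (hlt : K + 2 < N) :
    3 * |b| / (8 * (|a + 4 * b| + 1)) * Real.sqrt N * normU12 N (bump hlt.le : Disp N) ≤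
      normU12 N (Gqce N K a b (bump hlt.le)) := by
  set g := Gqce N K a b (bump hlt.le) with hg
  have h1 := abs_ip_Lqce_plateau_le hK hlt.le a b g
  rw [hg, Lqce_Gqce h, ip_residual_bump hK hlt, ← hg] at h1
  have hg0 := normU12_nonneg N g
  -- `3/2` and, below, `5/2` are rational upper bounds for `√2` and `√6`.
  have hw : normU12 N (plateau N K) ≤ 3 / 2 :=
    le_of_sq_le_sq ((normU12_plateau_sq_le (by omega)).trans (by norm_num)) (by norm_num)
  have hv : normU12 N (bump hlt.le : Disp N) ≤ 5 / 2 * Real.sqrt N := by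
    refine le_of_sq_le_sq ?_ (by positivity)
    rw [normU12_bump_sq, mul_pow, Real.sq_sqrt (by positivity)]
    have : (0 : ℝ) ≤ N := by positivity
    linarith
  -- Here `K ≤ N/2` enters: it keeps the plateau height at least `1/4` once `N ≥ 8`.
  have hW : (N : ℝ) / 4 ≤ (N : ℝ) - K - 2 := by
    have e1 : (8 : ℝ) ≤ N := by exact_mod_cast hN
    have e2 : 2 * (K : ℝ) ≤ N := by exact_mod_cast hKN
    linarith
  have hN0 : (0 : ℝ) ≤ N := by positivity
  have hA := abs_nonneg (a + 4 * b)
  have hb := abs_nonneg b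
  rw [abs_mul, abs_mul, abs_of_nonneg (by linarith : (0 : ℝ) ≤ (N : ℝ) - K - 2)] at h1
  norm_num at h1
  have h2 : |a + 4 * b| * (normU12 N g * normU12 N (plateau N K)) ≤
      (|a + 4 * b| + 1) * (normU12 N g * (3 / 2)) :=
    mul_le_mul (by linarith) (mul_le_mul_of_nonneg_left hw hg0)
      (mul_nonneg hg0 (normU12_nonneg _ _)) (by linarith)
  have h3 : 6 * |b| * ((N : ℝ) / 4) ≤ 6 * |b| * ((N : ℝ) - K - 2) :=
    mul_le_mul_of_nonneg_left hW (by positivity)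
  have h4 : |b| * N ≤ (|a + 4 * b| + 1) * normU12 N g := by linarith
  calc _ ≤ 3 * |b| / (8 * (|a + 4 * b| + 1)) * Real.sqrt N * (5 / 2 * Real.sqrt N) :=
        mul_le_mul_of_nonneg_left hv (by positivity)
    _ = 15 / 16 * (|b| * (Real.sqrt N * Real.sqrt N)) / (|a + 4 * b| + 1) := by
        field_simp
        ring
    _ ≤ normU12 N g := by
        rw [Real.mul_self_sqrt hN0, div_le_iff₀ (by linarith)]
        have : 0 ≤ |b| * N := by positivity
        linarith

end QC

end

/-! ### Assembly of the two bounds -/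

theorem mainTheorem5 (a b : ℝ) (ha : 0 < a) (hb : b ≠ 0) :
    ∃ C : ℝ, 0 < C ∧ ∃ N₀ : ℕ, ∀ N : ℕ, N₀ ≤ N → ∀ K : ℕ, 2 ≤ K → 2 * K ≤ N →
      0 < (a + 4 * b) + QC.lamK K * b →
        IsUnit (QC.Lqce N K a b) ∧
        C⁻¹ * Real.sqrt (N : ℝ) ≤ QC.opNormU12 N (QC.Gqce N K a b) ∧
        QC.opNormU12 N (QC.Gqce N K a b) ≤ C * Real.sqrt (N : ℝ) ∧
        1 < QC.opNormU12 N (QC.Gqce N K a b) := by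
  obtain ⟨c, hc, hcoer⟩ := QC.exists_uniform_coercivity b ha
  have hb' : 0 < |b| := abs_pos.mpr hb
  set C₁ := 16 * Real.sqrt 2 * |b| / c with hC₁
  set C₂ := 3 * |b| / (8 * (|a + 4 * b| + 1)) with hC₂
  have hC₁0 : 0 < C₁ := by positivity
  have hC₂0 : 0 < C₂ := by positivity
  -- `C = C₁ + C₂⁻¹` dominates `C₁` and has `C⁻¹ ≤ C₂`, so it serves both bounds. The threshold `8`
  -- is for the plateau, and `N > C²` turns the lower bound into a norm above 1.
  refine ⟨C₁ + C₂⁻¹, by positivity, max 8 (⌈(C₁ + C₂⁻¹) ^ 2⌉₊ + 1), ?_⟩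
  intro N hN K hK hKN hpos
  have hN8 : 8 ≤ N := (le_max_left _ _).trans hN
  have hN0 : 0 < N := by omega
  have hlt : K + 2 < N := by omega
  have hco := hcoer N K hK hlt.le hpos
  have hunit := QC.isUnit_Lqce_of_coercive hN0 hc hco
  have hle : ∀ r ∈ {r : ℝ | ∃ v : QC.Disp N, v ≠ 0 ∧
      r = QC.normU12 N (QC.Gqce N K a b v) / QC.normU12 N v}, r ≤ C₁ * Real.sqrt N := by
    rintro r ⟨v, hv, rfl⟩
    rw [div_le_iff₀ (QC.normU12_pos hN0 hv)]
    exact QC.normU12_Gqce_le hN0 hc hco v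
  have hbump : 0 < QC.normU12 N (QC.bump hlt.le : QC.Disp N) := by
    have h1 := QC.normU12_bump_sq (N := N) (K := K) hlt.le
    have h2 : (0 : ℝ) < N := by exact_mod_cast hN0
    refine (QC.normU12_nonneg _ _).lt_of_ne fun h0 => ?_
    rw [← h0] at h1
    linarith
  have hbump_ne : (QC.bump hlt.le : QC.Disp N) ≠ 0 := by
    intro h0
    rw [h0] at hbump
    simp [QC.normU12, QC.strain] at hbump
  have hlow : C₂ * Real.sqrt N ≤ QC.opNormU12 N (QC.Gqce N K a b) := by
    -- The upper bound `hle` is needed here as well: it makes the set of quotients bounded, so that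
    -- its `sSup` dominates the quotient of the bump.
    refine le_trans ?_ (le_csSup ⟨_, hle⟩ ⟨QC.bump hlt.le, hbump_ne, rfl⟩)
    rw [le_div_iff₀ hbump]
    exact QC.le_normU12_Gqce_bump hK hN8 hKN hunit hlt
  have hs := Real.sqrt_nonneg (N : ℝ)
  have hinv : (C₁ + C₂⁻¹)⁻¹ ≤ C₂ := by
    rw [inv_le_comm₀ (by positivity) hC₂0]
    linarith
  have hfirst : (C₁ + C₂⁻¹)⁻¹ * Real.sqrt N ≤ QC.opNormU12 N (QC.Gqce N K a b) :=
    (mul_le_mul_of_nonneg_right hinv hs).trans hlow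
  refine ⟨hunit, hfirst, ?_, lt_of_lt_of_le ?_ hfirst⟩
  · refine (Real.sSup_le hle (by positivity)).trans (mul_le_mul_of_nonneg_right ?_ hs)
    linarith [inv_pos.mpr hC₂0]
  · rw [inv_mul_eq_div, one_lt_div (by positivity)]
    apply Real.lt_sqrt_of_sq_lt
    have h1 : ((⌈(C₁ + C₂⁻¹) ^ 2⌉₊ + 1 : ℕ) : ℝ) ≤ N := by
      exact_mod_cast (le_max_right _ _).trans hN
    push_cast at h1
    linarith [Nat.le_ceil ((C₁ + C₂⁻¹) ^ 2)]
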